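/- Let $V$ be the node set of a complete graph with $n\ge 1$ nodes. Each node is in one of three states: agnostic (no colour), red, or blue; red and blue nodes are called gnostic. Consider the asynchronous pull voter model with agnostic nodes: in each round, independently of the past, a node $v$ is chosen uniformly at random from $V$, and $v$ selects a node $u$ uniformly at random from the other $n-1$ nodes (if $n=1$, nothing happens). If $u$ is agnostic, no state changes; if $u$ is gnostic, $v$ adopts the colour of $u$. Let $S_t\in\{\text{agnostic},\text{red},\text{blue}\}^V$ be the configuration after $t$ rounds. Fix an initial configuration $S_0$ with at least one gnostic node, and let $$\gamma=\frac{|\{v : S_0(v)=\text{red}\}|}{|\{v : S_0(v)\in\{\text{red},\text{blue}\}\}|}.$$ For $u\in V$ let $R(u)$ be the event that $u$ is gnostic at some time and is red at the first time at which it is gnostic. Then $$\mathbb P(R(u)\mid S_0)=\gamma\qquad\text{for every node } u \text{ that is agnostic in } S_0,$$ and $$\mathbb P(\text{red wins}\mid S_0)=\gamma,$$ where red wins if $S_t(v)=\text{red}$ for all $v\in V$ at some time $t\ge 0$. -/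

import Mathlib

namespace AgnosticVoter

/-- The state of a node: without a colour (agnostic), or with one of the two colours (gnostic). -/
inductive Opinion
  | agnostic
  | red
  | blue
  deriving DecidableEq

/-- One pull: node `v` has selected node `u`. It copies the colour of `u` if `u` is gnostic,
and nothing happens if `u` is agnostic. -/
def pull {V : Type*} [DecidableEq V] (s : V → Opinion) (v u : V) : V → Opinion :=
  if s u = Opinion.agnostic then s else Function.update s v (s u)

/-- Uniform selection of a neighbour of `v` in the graph `G`. Each row of selection weights must
sum to one, so a node without neighbours gets a loop of weight one; this occurs in a complete
graph only if it has a single node. -/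
noncomputable def neighbourLaw {V : Type*} [Fintype V] (G : SimpleGraph V) [DecidableRel G.Adj]
    (v : V) : PMF V :=
  if h : (G.neighborFinset v).Nonempty then PMF.uniformOfFinset (G.neighborFinset v) h
  else PMF.pure v

/-- The law of the pair `(v, u)` in an asynchronous round: the acting node `v` is uniform among
all nodes, and given `v`, the selected node `u` is a uniform neighbour of `v`. -/
noncomputable def selectionLaw {V : Type*} [Fintype V] [Nonempty V] (G : SimpleGraph V)
    [DecidableRel G.Adj] : PMF (V × V) :=
  (PMF.uniformOfFintype V).bind fun v => (neighbourLaw G v).map fun u => (v, u)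

/-- The probability measure of the asynchronous process on sequences of selections: the
selections of the rounds `0, 1, 2, …` are independent, each with law `selectionLaw G`. -/
noncomputable def asyncMeasure {V : Type*} [Fintype V] [Nonempty V] [MeasurableSpace V]
    (G : SimpleGraph V) [DecidableRel G.Adj] : MeasureTheory.Measure (ℕ → V × V) :=
  MeasureTheory.Measure.infinitePi fun _ : ℕ => (selectionLaw G).toMeasure

/-- The configuration `S_t` after `t` rounds of the asynchronous pull voter model with agnostic
nodes, started in `s₀`, as a function of the sequence `ω` of selections. -/
def state {V : Type*} [DecidableEq V] (s₀ : V → Opinion) (ω : ℕ → V × V) : ℕ → V → Opinion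
  | 0 => s₀
  | t + 1 => pull (state s₀ ω t) (ω t).1 (ω t).2

/-- The event `R(u)`: node `u` becomes gnostic, and the first colour it has is red. -/
def becomesRed {V : Type*} [DecidableEq V] (s₀ : V → Opinion) (u : V) : Set (ℕ → V × V) :=
  {ω | ∃ t, state s₀ ω t u = Opinion.red ∧ ∀ i < t, state s₀ ω i u = Opinion.agnostic}

/-- The event that red wins: a configuration in which all nodes are red is reached. -/
def redWins {V : Type*} [DecidableEq V] (s₀ : V → Opinion) : Set (ℕ → V × V) :=
  {ω | ∃ t, ∀ v, state s₀ ω t v = Opinion.red}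

/-- The proportion of red nodes among the gnostic ones. -/
noncomputable def redFraction {V : Type*} [Fintype V] (s : V → Opinion) : ℝ :=
  ((Finset.univ.filter fun v => s v = Opinion.red).card : ℝ) /
    ((Finset.univ.filter fun v => s v ≠ Opinion.agnostic).card : ℝ)

end AgnosticVoter

/-! ### Colour counts and the drift of the red proportion. -/

namespace AgnosticVoter
open Finset

/-! Let `r` and `b` be the numbers of red and blue nodes. The proportion `r / (r + b)` is a
martingale: an acting agnostic node gains a colour drawn in the current proportion, which preserves
the mean, and red-to-blue flips are as likely as blue-to-red ones (`sum_sum_redFraction_pull_sub`).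
On consensus it equals the indicator of red, so its initial value is the probability that red wins.
For the first colour of `w`, the process is stopped when `w` becomes gnostic. The martingale is then
the proportion while `w` is agnostic and the indicator of red at `w` afterwards
(`sum_sum_firstRedProb_stoppedPull_sub`). Both claims follow from
`measureReal_exists_trajectory_mem`, which identifies a harmonic function having the right boundary
values with a hitting probability. Its input is almost sure absorption, obtained from a maximum
principle in `tendsto_transition_iterate_indicator`. -/

/-- The number of nodes with opinion `c`, as a real number. -/
noncomputable def opinionCount {V : Type*} [Fintype V] (s : V → Opinion) (c : Opinion) : ℝ :=
  ∑ v, if s v = c then 1 else 0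

section Counts

variable {V : Type*} [Fintype V]

lemma opinionCount_eq_card (s : V → Opinion) (c : Opinion) :
    opinionCount s c = ((univ.filter fun v => s v = c).card : ℝ) := by
  simp [opinionCount]

lemma opinionCount_nonneg (s : V → Opinion) (c : Opinion) : 0 ≤ opinionCount s c := by
  rw [opinionCount_eq_card]; positivity

lemma opinionCount_pos {s : V → Opinion} {c : Opinion} {v : V} (h : s v = c) :
    0 < opinionCount s c := by
  rw [opinionCount_eq_card]
  exact_mod_cast card_pos.2 ⟨v, by simp [h]⟩

lemma redFraction_eq (s : V → Opinion) :
    redFraction s = opinionCount s .red / (opinionCount s .red + opinionCount s .blue) := by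
  unfold redFraction
  rw [← opinionCount_eq_card]
  congr 1
  rw [opinionCount, opinionCount, ← sum_add_distrib, card_eq_sum_ones, sum_filter]
  push_cast
  refine sum_congr rfl fun v _ => ?_
  cases s v <;> simp

lemma opinionCount_update [DecidableEq V] (s : V → Opinion) (v : V) (c d : Opinion) :
    opinionCount (Function.update s v d) c =
      opinionCount s c - (if s v = c then 1 else 0) + (if d = c then 1 else 0) := by
  unfold opinionCount
  rw [← add_sum_erase univ _ (mem_univ v), ← add_sum_erase univ (fun w => if s w = c then _ else _)
    (mem_univ v)]
  have : ∑ w ∈ univ.erase v, (if Function.update s v d w = c then (1 : ℝ) else 0) =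
      ∑ w ∈ univ.erase v, if s w = c then 1 else 0 :=
    sum_congr rfl fun w hw => by rw [Function.update_of_ne (ne_of_mem_erase hw)]
  rw [this, Function.update_self]
  ring

lemma sum_opinion (s : V → Opinion) (f : Opinion → ℝ) :
    ∑ v, f (s v) = opinionCount s .agnostic * f .agnostic + opinionCount s .red * f .red +
      opinionCount s .blue * f .blue := by
  simp only [opinionCount, sum_mul, ← sum_add_distrib]
  refine sum_congr rfl fun v _ => ?_
  cases s v <;> simp

end Counts

lemma pull_self {V : Type*} [DecidableEq V] (s : V → Opinion) (v : V) : pull s v v = s := by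
  simp [pull]

section Drift

variable {V : Type*} [Fintype V] [DecidableEq V]

/-- The drift of the proportion of red nodes when `v` acts and selects a uniform node. -/
lemma sum_redFraction_pull_sub (s : V → Opinion) (v : V) :
    ∑ u, (redFraction (pull s v u) - redFraction s) =
      match s v with
      | .agnostic => 0
      | .red => -(opinionCount s .blue / (opinionCount s .red + opinionCount s .blue))
      | .blue => opinionCount s .red / (opinionCount s .red + opinionCount s .blue) := by
  -- The summand depends on `u` only through its colour, so the sum has one term per colour,
  -- weighted by its count.
  have key := sum_opinion s fun c => redFraction (if c = .agnostic then s else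
    Function.update s v c) - redFraction s
  simp only [redFraction_eq, opinionCount_update, if_true, sub_self, mul_zero, zero_add,
    reduceCtorEq, if_false] at key
  refine (Eq.trans (sum_congr rfl fun u _ => ?_) key).trans ?_
  · simp only [redFraction_eq]
    rfl
  have hr := opinionCount_nonneg s .red
  have hb := opinionCount_nonneg s .blue
  cases hv : s v with
  | agnostic =>
    simp only [reduceCtorEq, if_false]
    generalize opinionCount s .red = r at *
    generalize opinionCount s .blue = b at *
    rcases (add_nonneg hr hb).eq_or_lt with h0 | h0
    · obtain rfl : r = 0 := by linarith
      obtain rfl : b = 0 := by linarith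
      simp
    · have : r + b + 1 ≠ 0 := by positivity
      have h1 : r - 0 + 1 + (b - 0 + 0) ≠ 0 := by ring_nf; ring_nf at this; exact this
      have h2 : r - 0 + 0 + (b - 0 + 1) ≠ 0 := by ring_nf; ring_nf at this; exact this
      field_simp
      ring
  | red =>
    have hp := opinionCount_pos hv
    simp only [reduceCtorEq, if_false, if_true]
    generalize opinionCount s .red = r at *
    generalize opinionCount s .blue = b at *
    rw [show r - 1 + 1 + (b - 0 + 0) = r + b by ring, show r - 1 + 0 + (b - 0 + 1) = r + b by ring]
    field_simp
    ring
  | blue =>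
    have hp := opinionCount_pos hv
    simp only [reduceCtorEq, if_false, if_true]
    generalize opinionCount s .red = r at *
    generalize opinionCount s .blue = b at *
    rw [show r - 0 + 1 + (b - 1 + 0) = r + b by ring, show r - 0 + 0 + (b - 1 + 1) = r + b by ring]
    field_simp
    ring

/-- Agnostic acting nodes contribute nothing; the `r` red ones contribute `-b / (r + b)` each and
the `b` blue ones `r / (r + b)` each, so the total cancels. -/
lemma sum_sum_redFraction_pull_sub (s : V → Opinion) :
    ∑ v, ∑ u, (redFraction (pull s v u) - redFraction s) = 0 := by
  simp only [sum_redFraction_pull_sub]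
  rw [sum_opinion s fun c => match c with
      | .agnostic => 0
      | .red => -(opinionCount s .blue / (opinionCount s .red + opinionCount s .blue))
      | .blue => opinionCount s .red / (opinionCount s .red + opinionCount s .blue)]
  ring

/-- The process stopped when `w` becomes gnostic. -/
def stoppedPull (w : V) (s : V → Opinion) (v u : V) : V → Opinion :=
  if s w = .agnostic then pull s v u else s

/-- The conditional probability, given the configuration `s`, that the first colour of `w` is
red. -/
noncomputable def firstRedProb (w : V) (s : V → Opinion) : ℝ :=
  if s w = .agnostic then redFraction s else if s w = .red then 1 else 0

/-- While `w` is agnostic, the drift agrees with that of `redFraction` for each acting node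
separately. If another node acts, `w` stays agnostic and the two functions coincide. If `w` acts,
both drifts vanish: with `γ = r / (r + b)`, the new one is `r * (1 - γ) - b * γ = 0`. -/
lemma sum_sum_firstRedProb_stoppedPull_sub (w : V) (s : V → Opinion) :
    ∑ v, ∑ u, (firstRedProb w (stoppedPull w s v u) - firstRedProb w s) = 0 := by
  by_cases hw : s w = .agnostic
  swap
  · simp [stoppedPull, hw]
  rw [← sum_sum_redFraction_pull_sub s]
  refine sum_congr rfl fun v _ => ?_
  rcases eq_or_ne v w with rfl | hv
  · rw [sum_redFraction_pull_sub, hw]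
    have key := sum_opinion s fun c => firstRedProb v (if c = .agnostic then s else
      Function.update s v c) - firstRedProb v s
    refine (Eq.trans (sum_congr rfl fun u _ => ?_) key).trans ?_
    · simp [stoppedPull, hw, pull]
    · have hr := opinionCount_nonneg s .red
      have hb := opinionCount_nonneg s .blue
      simp only [firstRedProb, hw, redFraction_eq, if_true, reduceCtorEq, if_false,
        Function.update_self, sub_self, mul_zero, zero_add]
      generalize opinionCount s .red = r at *
      generalize opinionCount s .blue = b at *
      rcases (add_nonneg hr hb).eq_or_lt with h0 | h0
      · obtain rfl : r = 0 := by linarith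
        obtain rfl : b = 0 := by linarith
        simp
      · field_simp
        ring
  · refine sum_congr rfl fun u _ => ?_
    have : pull s v u w = .agnostic := by
      unfold pull
      split_ifs
      · exact hw
      · rw [Function.update_of_ne hv.symm, hw]
    simp [stoppedPull, firstRedProb, hw, this]

end Drift
end AgnosticVoter

/-! ### Hitting probabilities of finite Markov chains driven by i.i.d. noise. -/

namespace AgnosticVoter
open MeasureTheory ProbabilityTheory Filter Topology

/-- The trajectory from `x` of the random dynamical system with update rule `F`. -/
def trajectory {α β : Type*} (F : α → β → α) (x : α) (ω : ℕ → β) : ℕ → α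
  | 0 => x
  | t + 1 => F (trajectory F x ω t) (ω t)

/-- The transition operator of the Markov chain with update rule `F` and noise law `p`. -/
noncomputable def transition {α β : Type*} [Fintype β] (p : PMF β) (F : α → β → α)
    (g : α → ℝ) (x : α) : ℝ :=
  ∑ b, (p b).toReal * g (F x b)

section Chain

variable {α β : Type*}

lemma trajectory_congr (F : α → β → α) (x : α) {ω ω' : ℕ → β} {t : ℕ}
    (h : ∀ i < t, ω i = ω' i) : trajectory F x ω t = trajectory F x ω' t := by
  induction t with
  | zero => rfl
  | succ t ih =>
    rw [trajectory, trajectory, ih fun i hi => h i (by omega), h t (by omega)]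

variable [Fintype β]

lemma sum_toReal_pmf (p : PMF β) : ∑ b, (p b).toReal = 1 := by
  rw [← ENNReal.toReal_sum fun b _ => p.apply_ne_top b, ← tsum_fintype (L := .unconditional β),
    p.tsum_coe, ENNReal.toReal_one]

lemma transition_mono (p : PMF β) (F : α → β → α) : Monotone (transition p F) :=
  fun _ _ h _ => Finset.sum_le_sum fun _ _ => mul_le_mul_of_nonneg_left (h _) ENNReal.toReal_nonneg

/-- The iterates are the probabilities of not yet being in `A`. They decrease in `t` to a harmonic
limit `Q` that vanishes on `A`. By the maximum principle, every successor of positive probability of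
a maximiser of `Q` is again a maximiser; following successors that lower `φ` leads into `A`, so the
maximum is zero. -/
lemma tendsto_transition_iterate_indicator [Finite α] (p : PMF β) (F : α → β → α) {A : Set α}
    (hA : ∀ x ∈ A, ∀ b, F x b ∈ A) (φ : α → ℕ) (hφ : ∀ x ∉ A, ∃ b, p b ≠ 0 ∧ φ (F x b) < φ x)
    (x : α) :
    Tendsto (fun t => (transition p F)^[t] (Aᶜ.indicator 1) x) atTop (𝓝 0) := by
  set q : ℕ → α → ℝ := fun t => (transition p F)^[t] (Aᶜ.indicator 1) with hq
  have hnonneg : ∀ t y, 0 ≤ q t y := by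
    intro t
    induction t with
    | zero => exact fun y => Set.indicator_nonneg (fun _ _ => zero_le_one) y
    | succ t ih =>
      intro y
      simp only [hq, Function.iterate_succ_apply']
      exact Finset.sum_nonneg fun b _ => mul_nonneg ENNReal.toReal_nonneg (ih _)
  -- Since `A` is absorbing, the indicator of its complement is superharmonic; monotonicity of the
  -- operator passes this to all iterates.
  have hstep : transition p F (Aᶜ.indicator 1) ≤ Aᶜ.indicator 1 := by
    intro y
    by_cases hy : y ∈ A
    · simp [transition, hy, hA y hy]
    · rw [Set.indicator_of_mem (by exact hy), Pi.one_apply, ← sum_toReal_pmf p]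
      refine Finset.sum_le_sum fun b _ => mul_le_of_le_one_right ENNReal.toReal_nonneg ?_
      exact Set.indicator_le_self' (fun _ _ => zero_le_one) _
  have hanti : Antitone q := antitone_nat_of_succ_le fun t => by
    simp only [hq, Function.iterate_succ_apply]
    exact (transition_mono p F).iterate t hstep
  have hlim : ∀ y, ∃ l, Tendsto (fun t => q t y) atTop (𝓝 l) := fun y =>
    ⟨_, tendsto_atTop_ciInf (fun _ _ hst => hanti hst y)
      ⟨0, by rintro _ ⟨t, rfl⟩; exact hnonneg t y⟩⟩
  choose Q hQ using hlim
  have hharm : ∀ y, Q y = ∑ b, (p b).toReal * Q (F y b) := fun y => by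
    refine tendsto_nhds_unique ((tendsto_add_atTop_iff_nat 1).2 (hQ y)) ?_
    simp only [hq, Function.iterate_succ_apply']
    exact tendsto_finsetSum _ fun b _ => (hQ (F y b)).const_mul _
  have hQA : ∀ y ∈ A, Q y = 0 := fun y hy =>
    le_antisymm (le_of_tendsto (hQ y) (Eventually.of_forall fun t =>
      (hanti (Nat.zero_le t) y).trans (by simp [hq, hy])))
      (ge_of_tendsto' (hQ y) fun t => hnonneg t y)
  have : Nonempty α := ⟨x⟩
  obtain ⟨m, hm⟩ := Finite.exists_max Q
  have hmax : ∀ k y, φ y = k → Q y = Q m → Q m = 0 := by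
    intro k
    induction k using Nat.strong_induction_on with
    | _ k ih =>
      intro y hk hy
      by_cases hyA : y ∈ A
      · rw [← hy, hQA y hyA]
      obtain ⟨b, hb, hlt⟩ := hφ y hyA
      refine ih _ (hk ▸ hlt) (F y b) rfl ?_
      -- The nonnegative gaps `Q m - Q (F y b)` have weighted mean zero, so each gap of positive
      -- weight is zero.
      have hsum : ∑ b, (p b).toReal * (Q m - Q (F y b)) = 0 := by
        simp only [mul_sub, Finset.sum_sub_distrib, ← Finset.sum_mul, sum_toReal_pmf, one_mul]
        rw [← hharm, hy, sub_self]
      have hz := (Finset.sum_eq_zero_iff_of_nonneg fun b _ =>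
        mul_nonneg ENNReal.toReal_nonneg (sub_nonneg.2 (hm (F y b)))).1 hsum b (Finset.mem_univ b)
      have hpb : (p b).toReal ≠ 0 := ENNReal.toReal_ne_zero.2 ⟨hb, p.apply_ne_top b⟩
      linarith [(mul_eq_zero.1 hz).resolve_left hpb]
  have hQx : Q x = 0 :=
    le_antisymm ((hm x).trans_eq (hmax _ m rfl rfl)) (ge_of_tendsto' (hQ x) fun t => hnonneg t x)
  exact hQx ▸ hQ x

variable [MeasurableSpace β] [DiscreteMeasurableSpace β] [MeasurableSpace α]

/-- The position at time `t` is a function of the noise coordinates below `t` alone. -/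
lemma indepFun_trajectory_eval (p : PMF β) (F : α → β → α) (x : α) (t : ℕ) :
    IndepFun (fun ω => trajectory F x ω t) (fun ω => ω t)
      (Measure.infinitePi fun _ : ℕ => p.toMeasure) := by
  have hi : iIndepFun (fun (i : ℕ) (ω : ℕ → β) => ω i)
      (Measure.infinitePi fun _ : ℕ => p.toMeasure) :=
    iIndepFun_infinitePi (X := fun _ b => b) fun _ => measurable_id
  have h := hi.indepFun_finset (Finset.range t) {t} (by simp) fun i => measurable_pi_apply i
  -- An arbitrary filler for the coordinates from `t` on, which the trajectory up to time `t` does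
  -- not read.
  obtain ⟨b₀, -⟩ := p.support_nonempty
  let φ : (Finset.range t → β) → α := fun η =>
    trajectory F x (fun i => if hi : i ∈ Finset.range t then η ⟨i, hi⟩ else b₀) t
  have hψ : Measurable fun η : ({t} : Finset ℕ) → β => η ⟨t, Finset.mem_singleton_self t⟩ :=
    measurable_pi_apply _
  have := h.comp (measurable_of_countable φ) hψ
  convert this using 1
  · funext ω
    refine trajectory_congr F x fun i hi => ?_
    simp [hi]
  · rfl

variable [Finite α] [DiscreteMeasurableSpace α]

lemma measurable_trajectory (F : α → β → α) (x : α) (t : ℕ) :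
    Measurable fun ω => trajectory F x ω t := by
  induction t with
  | zero => exact measurable_const
  | succ t ih =>
    exact (measurable_of_countable fun q : α × β => F q.1 q.2).comp
      (ih.prodMk (measurable_pi_apply t))

lemma integral_trajectory_succ (p : PMF β) (F : α → β → α) (x : α) (g : α → ℝ) (t : ℕ) :
    ∫ ω, g (trajectory F x ω (t + 1)) ∂(Measure.infinitePi fun _ : ℕ => p.toMeasure) =
      ∫ ω, transition p F g (trajectory F x ω t)
        ∂(Measure.infinitePi fun _ : ℕ => p.toMeasure) := by
  set μ := Measure.infinitePi fun _ : ℕ => p.toMeasure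
  have hX := measurable_trajectory F x t
  have hmap := (indepFun_trajectory_eval p F x t).map_prod_eq_prod_map_map hX.aemeasurable
    (measurable_pi_apply t).aemeasurable
  have hev : μ.map (fun ω => ω t) = p.toMeasure := Measure.infinitePi_map_eval _ t
  rw [hev] at hmap
  have : IsProbabilityMeasure (μ.map fun ω => trajectory F x ω t) :=
    Measure.isProbabilityMeasure_map hX.aemeasurable
  calc ∫ ω, g (trajectory F x ω (t + 1)) ∂μ
      = ∫ q : α × β, g (F q.1 q.2) ∂(μ.map fun ω => (trajectory F x ω t, ω t)) := by
        rw [integral_map (hX.prodMk (measurable_pi_apply t)).aemeasurable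
          (measurable_of_countable _).aestronglyMeasurable]
        rfl
    _ = ∫ y, transition p F g y ∂(μ.map fun ω => trajectory F x ω t) := by
        rw [hmap, integral_prod _ .of_finite]
        refine integral_congr_ae (Eventually.of_forall fun y => ?_)
        simp only [PMF.integral_eq_sum, transition, smul_eq_mul]
    _ = _ := integral_map hX.aemeasurable (measurable_of_countable _).aestronglyMeasurable

lemma integral_trajectory (p : PMF β) (F : α → β → α) (x : α) (g : α → ℝ) (t : ℕ) :
    ∫ ω, g (trajectory F x ω t) ∂(Measure.infinitePi fun _ : ℕ => p.toMeasure) =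
      (transition p F)^[t] g x := by
  induction t generalizing g with
  | zero => simp [trajectory]
  | succ t ih => rw [integral_trajectory_succ, ih, Function.iterate_succ_apply]

lemma integrable_trajectory (p : PMF β) (F : α → β → α) (x : α) (g : α → ℝ) (t : ℕ) :
    Integrable (fun ω => g (trajectory F x ω t))
      (Measure.infinitePi fun _ : ℕ => p.toMeasure) := by
  have hX := measurable_trajectory F x t
  have : IsProbabilityMeasure
      ((Measure.infinitePi fun _ : ℕ => p.toMeasure).map fun ω => trajectory F x ω t) :=
    Measure.isProbabilityMeasure_map hX.aemeasurable
  exact (Integrable.of_finite (f := g)).comp_measurable hX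

/-- Let `h` be a harmonic function of a finite Markov chain that is absorbed in `A`, and let `h`
be the indicator of the absorbing set `R` on `A`. Then `h x` is the probability that the chain
started in `x` reaches `R`. -/
theorem measureReal_exists_trajectory_mem (p : PMF β) (F : α → β → α) {A R : Set α}
    (hA : ∀ x ∈ A, ∀ b, F x b ∈ A) (hR : ∀ x ∈ R, ∀ b, F x b ∈ R)
    (φ : α → ℕ) (hφ : ∀ x ∉ A, ∃ b, p b ≠ 0 ∧ φ (F x b) < φ x)
    (h : α → ℝ) (hh : transition p F h = h) (hAR : ∀ x ∈ A, h x = R.indicator 1 x) (x : α) :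
    (Measure.infinitePi fun _ : ℕ => p.toMeasure).real {ω | ∃ t, trajectory F x ω t ∈ R} =
      h x := by
  set μ := Measure.infinitePi fun _ : ℕ => p.toMeasure
  have hmono : Monotone fun t => {ω : ℕ → β | trajectory F x ω t ∈ R} :=
    monotone_nat_of_le_succ fun t ω hω => hR _ hω _
  have hunion : {ω | ∃ t, trajectory F x ω t ∈ R} = ⋃ t, {ω | trajectory F x ω t ∈ R} := by
    ext ω; simp
  have h₁ : Tendsto (fun t => μ.real {ω | trajectory F x ω t ∈ R}) atTop
      (𝓝 (μ.real {ω | ∃ t, trajectory F x ω t ∈ R})) := by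
    rw [hunion]
    exact (ENNReal.tendsto_toReal (measure_ne_top _ _)).comp (tendsto_measure_iUnion_atTop hmono)
  have hint : ∀ t, μ.real {ω | trajectory F x ω t ∈ R} =
      ∫ ω, R.indicator 1 (trajectory F x ω t) ∂μ := fun t => by
    have : MeasurableSet {ω | trajectory F x ω t ∈ R} :=
      measurable_trajectory F x t (MeasurableSet.of_discrete (s := R))
    rw [← integral_indicator_one this]
    rfl
  have hconst : ∀ t, ∫ ω, h (trajectory F x ω t) ∂μ = h x := fun t => by
    rw [integral_trajectory, Function.iterate_fixed hh]
  obtain ⟨C, hC⟩ : ∃ C : ℝ, ∀ y, |R.indicator 1 y - h y| ≤ C := by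
    obtain ⟨C, hC⟩ := (Set.finite_range fun y => |R.indicator 1 y - h y|).bddAbove
    exact ⟨C, fun y => hC ⟨y, rfl⟩⟩
  -- The mean of `h` along the chain is constantly `h x`, and `h` differs from the indicator of `R`
  -- only outside `A`. Hence the error at time `t` is at most `C` times the probability of not yet
  -- being absorbed.
  have hbound : ∀ y, ‖R.indicator 1 y - h y‖ ≤ C * Aᶜ.indicator 1 y := fun y => by
    by_cases hy : y ∈ A
    · simp [hAR y hy, hy]
    · simpa [hy] using hC y
  refine tendsto_nhds_unique h₁ (tendsto_iff_norm_sub_tendsto_zero.2 ?_)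
  have hzero := (tendsto_transition_iterate_indicator p F hA φ hφ x).const_mul C
  rw [mul_zero] at hzero
  refine squeeze_zero (fun _ => norm_nonneg _) (fun t => ?_) hzero
  rw [hint, ← hconst t, ← integral_sub (integrable_trajectory p F x _ t)
    (integrable_trajectory p F x _ t), ← integral_trajectory p F x _ t, ← integral_const_mul]
  exact norm_integral_le_of_norm_le ((integrable_trajectory p F x _ t).const_mul C)
    (Eventually.of_forall fun ω => hbound _)

end Chain
end AgnosticVoter

/-! ### Selections in the complete graph, and application to the voter model. -/

namespace AgnosticVoter
open Finset

section Selection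

variable {V : Type*} [Fintype V] [DecidableEq V] [Nonempty V]

lemma exists_selectionLaw_top_eq :
    ∃ c : ENNReal, c ≠ 0 ∧
      ∀ v u : V, v ≠ u → selectionLaw (⊤ : SimpleGraph V) (v, u) = c := by
  -- With a single node this value is `⊤`, still nonzero, and the claim about distinct pairs is
  -- vacuous.
  refine ⟨(Fintype.card V : ENNReal)⁻¹ * ((Fintype.card V - 1 : ℕ) : ENNReal)⁻¹, by simp, ?_⟩
  intro v u hvu
  have hne : ((⊤ : SimpleGraph V).neighborFinset v).Nonempty := ⟨u, by simpa using hvu.symm⟩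
  have hcard : ((⊤ : SimpleGraph V).neighborFinset v).card = Fintype.card V - 1 := by
    rw [SimpleGraph.card_neighborFinset_eq_degree, SimpleGraph.complete_graph_degree]
  rw [selectionLaw, PMF.bind_apply, tsum_eq_single v]
  · rw [PMF.uniformOfFintype_apply, PMF.map_apply, tsum_eq_single u]
    · rw [if_pos rfl, neighbourLaw, dif_pos hne, PMF.uniformOfFinset_apply_of_mem hne
        (by simpa using hvu.symm), hcard]
    · intro w hw
      rw [if_neg (by simpa using hw.symm)]
  · intro w hw
    rw [PMF.map_apply, ENNReal.tsum_eq_zero.2, mul_zero]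
    intro z
    rw [if_neg (by simp [hw.symm])]

/-- Selecting oneself has no effect, so that a function whose drift vanishes for a uniform pair of
nodes is harmonic. -/
lemma transition_selectionLaw_top_eq (F : (V → Opinion) → V → V → V → Opinion)
    (hF : ∀ s v, F s v v = s) (h : (V → Opinion) → ℝ)
    (hh : ∀ s, ∑ v, ∑ u, (h (F s v u) - h s) = 0) :
    transition (selectionLaw (⊤ : SimpleGraph V)) (fun s q => F s q.1 q.2) h = h := by
  obtain ⟨c, -, hc⟩ := exists_selectionLaw_top_eq (V := V)
  funext s
  rw [← sub_eq_zero]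
  calc transition (selectionLaw (⊤ : SimpleGraph V)) (fun s q => F s q.1 q.2) h s - h s
      = ∑ q : V × V, (selectionLaw (⊤ : SimpleGraph V) q).toReal * (h (F s q.1 q.2) - h s) := by
        simp only [mul_sub, sum_sub_distrib, ← sum_mul, sum_toReal_pmf, one_mul, transition]
    _ = ∑ q : V × V, c.toReal * (h (F s q.1 q.2) - h s) := by
        refine sum_congr rfl fun q _ => ?_
        obtain ⟨v, u⟩ := q
        rcases eq_or_ne v u with rfl | hvu
        · simp [hF]
        · rw [hc v u hvu]
    _ = 0 := by
        rw [← mul_sum, Fintype.sum_prod_type, hh, mul_zero]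

end Selection

instance : Finite Opinion :=
  Finite.of_injective (fun c : Opinion => (decide (c = .red), decide (c = .blue))) fun a b => by
    cases a <;> cases b <;> simp

section Voter

variable {V : Type*} [DecidableEq V]

lemma trajectory_pull (s₀ : V → Opinion) (ω : ℕ → V × V) (t : ℕ) :
    trajectory (fun s (q : V × V) => pull s q.1 q.2) s₀ ω t = state s₀ ω t := by
  induction t with
  | zero => rfl
  | succ t ih => rw [trajectory, state, ih]

lemma trajectory_stoppedPull {s₀ : V → Opinion} {w : V} {ω : ℕ → V × V} {t : ℕ}
    (h : ∀ i < t, state s₀ ω i w = .agnostic) :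
    trajectory (fun s (q : V × V) => stoppedPull w s q.1 q.2) s₀ ω t = state s₀ ω t := by
  induction t with
  | zero => rfl
  | succ t ih =>
    rw [trajectory, state, ih fun i hi => h i (by omega), stoppedPull, if_pos (h t (by omega))]

lemma pull_apply_of_forall {s : V → Opinion} {c : Opinion} (h : ∀ v, s v = c) (v u : V) :
    pull s v u = s := by
  unfold pull
  split_ifs
  · rfl
  · rw [h u, ← h v, Function.update_eq_self]

/-- The stopped process agrees with the original one until `w` becomes gnostic and is frozen from
then on. If it ever shows `w` red, then `w` was agnostic at all times before the first such time. -/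
lemma becomesRed_eq (s₀ : V → Opinion) (w : V) :
    becomesRed s₀ w = {ω | ∃ t,
      trajectory (fun s (q : V × V) => stoppedPull w s q.1 q.2) s₀ ω t ∈ {s | s w = .red}} := by
  ext ω
  simp only [becomesRed, Set.mem_ofPred_eq]
  constructor
  · rintro ⟨t, ht, h⟩
    exact ⟨t, by rwa [trajectory_stoppedPull h]⟩
  · intro hex
    set Y := trajectory (fun s (q : V × V) => stoppedPull w s q.1 q.2) s₀ ω with hY
    have hfrozen : ∀ i, Y i w ≠ .agnostic → ∀ j, Y (i + j) = Y i := by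
      intro i hi j
      induction j with
      | zero => rfl
      | succ j ih =>
        rw [← ih] at hi
        rw [← ih, ← add_assoc, hY, trajectory, stoppedPull, if_neg hi]
    obtain ⟨t, ht, hmin⟩ : ∃ t, Y t w = .red ∧ ∀ i < t, Y i w ≠ .red :=
      ⟨Nat.find hex, Nat.find_spec hex, fun i hi => Nat.find_min hex hi⟩
    have hag : ∀ i < t, Y i w = .agnostic := fun i hi => by
      by_contra hne
      have := hfrozen i hne (t - i)
      rw [Nat.add_sub_cancel' hi.le] at this
      exact hmin i hi (this ▸ ht)
    -- `hag` concerns the stopped process, whereas `trajectory_stoppedPull` needs `w` agnostic in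
    -- the original one; strong induction transfers this from earlier times.
    have hst : ∀ i ≤ t, Y i = state s₀ ω i := fun i => by
      induction i using Nat.strong_induction_on with
      | _ i ih =>
        exact fun hi => trajectory_stoppedPull fun j hj => by
          rw [← ih j hj (by omega)]; exact hag j (by omega)
    exact ⟨t, hst t le_rfl ▸ ht, fun i hi => hst i hi.le ▸ hag i hi⟩

variable [Fintype V]

/-- The number of nodes to convert until consensus, in red if there is a red node. -/
noncomputable def consensusDistance {V : Type*} [Fintype V] (s : V → Opinion) : ℕ :=
  open Classical in
  if ∃ v, s v = .red then (univ.filter fun v => s v ≠ .red).card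
  else (univ.filter fun v => s v ≠ .blue).card

lemma card_filter_ne_update_lt {s : V → Opinion} {c : Opinion} {v : V} (h : s v ≠ c) :
    (univ.filter fun x => Function.update s v c x ≠ c).card <
      (univ.filter fun x => s x ≠ c).card := by
  refine card_lt_card ⟨fun x hx => ?_, fun hsub => ?_⟩
  · rcases eq_or_ne x v with rfl | hxv
    · simpa using h
    · simpa [Function.update_of_ne hxv] using hx
  · have := hsub (x := v) (by simpa using h)
    simp at this

variable [Nonempty V] [MeasurableSpace V] [DiscreteMeasurableSpace V]

theorem asyncMeasure_becomesRed (s₀ : V → Opinion) {w : V} (hw : s₀ w = .agnostic) :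
    (asyncMeasure (⊤ : SimpleGraph V)).real (becomesRed s₀ w) = redFraction s₀ := by
  let _ : MeasurableSpace (V → Opinion) := ⊤
  have : DiscreteMeasurableSpace (V → Opinion) := ⟨fun _ => trivial⟩
  obtain ⟨c, hc0, hc⟩ := exists_selectionLaw_top_eq (V := V)
  have key := measureReal_exists_trajectory_mem (selectionLaw (⊤ : SimpleGraph V))
    (fun s (q : V × V) => stoppedPull w s q.1 q.2)
    -- The all-agnostic configuration is also absorbing and has to lie in `A`; there `redFraction`
    -- is `0 / 0 = 0`, the required boundary value. From outside `A`, a single pull of a gnostic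
    -- node by `w` enters `A`, so a potential with values 0 and 1 suffices.
    (A := {s | s w ≠ .agnostic ∨ ∀ v, s v = .agnostic}) (R := {s | s w = .red})
    ?_ ?_ (fun s => if s w = .agnostic then 1 else 0) ?_ (firstRedProb w)
    (transition_selectionLaw_top_eq (stoppedPull w) ?_ _ (sum_sum_firstRedProb_stoppedPull_sub w))
    ?_ s₀
  · rw [becomesRed_eq, asyncMeasure, key, firstRedProb, if_pos hw]
  · rintro s (hs | hs) q
    · exact Or.inl (by simp [stoppedPull, hs])
    · refine Or.inr ?_
      simpa [stoppedPull, hs w, pull_apply_of_forall hs] using hs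
  · intro s (hs : s w = .red) q
    simp [stoppedPull, hs]
  · intro s hs
    simp only [Set.mem_ofPred_eq, not_or, not_not, not_forall] at hs
    obtain ⟨hsw, v, hv⟩ := hs
    refine ⟨(w, v), ?_, ?_⟩
    · rw [hc w v (by rintro rfl; exact hv hsw)]
      exact hc0
    · simp [stoppedPull, pull, hsw, hv]
  · intro s v
    simp [stoppedPull, pull_self]
  · rintro s (hs | hs)
    · simp [firstRedProb, hs, Set.indicator_apply]
    · simp [firstRedProb, hs, redFraction]

theorem asyncMeasure_redWins (s₀ : V → Opinion) :
    (asyncMeasure (⊤ : SimpleGraph V)).real (redWins s₀) = redFraction s₀ := by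
  let _ : MeasurableSpace (V → Opinion) := ⊤
  have : DiscreteMeasurableSpace (V → Opinion) := ⟨fun _ => trivial⟩
  obtain ⟨c, hc0, hc⟩ := exists_selectionLaw_top_eq (V := V)
  have key := measureReal_exists_trajectory_mem (selectionLaw (⊤ : SimpleGraph V))
    (fun s (q : V × V) => pull s q.1 q.2)
    -- All-agnostic counts as a consensus here, again with `redFraction` equal to `0 / 0 = 0`.
    (A := {s | ∃ c, ∀ v, s v = c}) (R := {s | ∀ v, s v = .red})
    ?_ ?_ consensusDistance ?_ redFraction
    (transition_selectionLaw_top_eq pull pull_self _ sum_sum_redFraction_pull_sub)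
    ?_ s₀
  · rw [← key, asyncMeasure]
    simp only [trajectory_pull]
    rfl
  · rintro s ⟨c, hs⟩ q
    exact ⟨c, by simpa only [pull_apply_of_forall hs] using hs⟩
  · intro s hs q
    simpa only [pull_apply_of_forall hs] using hs
  · intro s hs
    simp only [Set.mem_ofPred_eq, not_exists, not_forall] at hs
    -- If a red node exists, letting a non-red node pull it lowers the distance to red consensus.
    -- Otherwise a non-blue node pulls a blue one; this creates no red node, so the distance is
    -- still measured to blue.
    by_cases hred : ∃ u, s u = .red
    · obtain ⟨u, hu⟩ := hred
      obtain ⟨v, hv⟩ := hs .red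
      refine ⟨(v, u), by rw [hc v u (by rintro rfl; exact hv hu)]; exact hc0, ?_⟩
      have hp : pull s v u = Function.update s v .red := by simp [pull, hu]
      simp only [hp]
      rw [consensusDistance, consensusDistance, if_pos ⟨v, by simp⟩, if_pos ⟨u, hu⟩]
      convert card_filter_ne_update_lt hv
    · obtain ⟨u, hu⟩ := hs .agnostic
      obtain ⟨v, hv⟩ := hs .blue
      have hu' : s u = .blue := by
        cases h : s u with
        | agnostic => exact absurd h hu
        | red => exact absurd ⟨u, h⟩ hred
        | blue => rfl
      refine ⟨(v, u), by rw [hc v u (by rintro rfl; exact hv hu')]; exact hc0, ?_⟩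
      have hp : pull s v u = Function.update s v .blue := by simp [pull, hu']
      simp only [hp]
      rw [consensusDistance, consensusDistance, if_neg hred, if_neg]
      · convert card_filter_ne_update_lt hv
      · rintro ⟨x, hx⟩
        rcases eq_or_ne x v with rfl | hxv
        · simp at hx
        · exact hred ⟨x, by rwa [Function.update_of_ne hxv] at hx⟩
  · rintro s ⟨c, hs⟩
    cases c <;> simp [redFraction, hs]

end Voter
end AgnosticVoter

/-- `V` carries the discrete σ-algebra. -/
theorem corollary1 {V : Type*} [Fintype V] [DecidableEq V] [Nonempty V]
    [MeasurableSpace V] [DiscreteMeasurableSpace V]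
    (s₀ : V → AgnosticVoter.Opinion)
    (hs₀ : ∃ v, s₀ v ≠ AgnosticVoter.Opinion.agnostic) :
    (∀ u, s₀ u = AgnosticVoter.Opinion.agnostic →
      (AgnosticVoter.asyncMeasure (⊤ : SimpleGraph V)).real (AgnosticVoter.becomesRed s₀ u) =
        AgnosticVoter.redFraction s₀) ∧
    (AgnosticVoter.asyncMeasure (⊤ : SimpleGraph V)).real (AgnosticVoter.redWins s₀) =
      AgnosticVoter.redFraction s₀ := by
  exact ⟨fun _ hu => AgnosticVoter.asyncMeasure_becomesRed s₀ hu,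
    AgnosticVoter.asyncMeasure_redWins s₀⟩
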